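/- Let $d\ge 1$ and $N,K\ge 0$ be integers. For $M\ge 0$ let $\mathrm{sym}^M(\mathbb C^d)\subseteq(\mathbb C^d)^{\otimes M}$ be the subspace of vectors invariant under all permutations of the tensor factors, let $\Pi^{(M)}_{\mathrm{sym}}$ be the orthogonal projector onto it, and put $d_S^M:=\dim \mathrm{sym}^M(\mathbb C^d)$. Let $\mathrm d\psi$ denote the uniform (Haar-induced) probability measure on unit vectors $|\psi\rangle\in\mathbb C^d$, write $\psi=|\psi\rangle\langle\psi|$, let ${}^{\mathsf T}$ be the transpose in the computational basis, and let $F(\rho,\psi)=\mathrm{Tr}(\rho\,\psi)$ be the fidelity of a state $\rho$ with a pure state $\psi$. Then $d_S^M=\binom{M+d-1}{d-1}$ for all $M$, and $$\max_{\mathcal C}\int \mathrm d\psi\; F\big(\mathcal C(\psi^{\otimes N}),(\psi^{\mathsf T})^{\otimes K}\big)=\frac{d_S^N}{d_S^{N+K}},$$ where the maximum is over all completely positive trace-preserving linear maps $\mathcal C:\mathcal L(\mathbb C^d)^{\otimes N}\to\mathcal L(\mathbb C^d)^{\otimes K}$ and is attained. Moreover it is attained by an estimation strategy, which acts on the symmetric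 subspace, $\mathcal T_{\mathrm{CP}}:\mathcal L(\mathrm{sym}^N(\mathbb C^d))\to\mathcal L(\mathbb C^d)^{\otimes K}$, as $$\mathcal T_{\mathrm{CP}}(\rho):=d_S^N\int \mathrm d\psi\;\mathrm{Tr}[\rho\,\psi^{\otimes N}]\,(\psi^{\mathsf T})^{\otimes K}=\frac{d_S^N}{d_S^{N+K}}\,\mathrm{Tr}_{1\ldots N}\!\left[\Pi^{(N+K)}_{\mathrm{sym}}\,(\rho^{\mathsf T}\otimes\mathbb 1_d^{\otimes K})\right],$$ where $\mathrm{Tr}_{1\ldots N}$ is the partial trace over the first $N$ subsystems. That is, $d_S^N\psi^{\otimes N}\,\mathrm d\psi$ is a POVM on $\mathrm{sym}^N(\mathbb C^d)$ (it is positive and integrates to $\Pi^{(N)}_{\mathrm{sym}}$), $\mathcal T_{\mathrm{CP}}$ measures it and prepares the state $(\psi^{\mathsf T})^{\otimes K}$ upon the outcome $\psi$, $\mathcal T_{\mathrm{CP}}$ is the restriction to $\mathcal L(\mathrm{sym}^N(\mathbb C^d))$ of a completely positive trace-preserving map on $\mathcal L(\mathbb C^d)^{\otimes N}$, and its average fidelity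 is $d_S^N/d_S^{N+K}$. -/

import Mathlib

open MeasureTheory
open scoped ComplexOrder

namespace QTranspose

/-- Computational basis of `(ℂ^d)^{⊗M}`: strings of length `M` over `{0, …, d-1}`. -/
abbrev Idx (d M : ℕ) : Type := Fin M → Fin d

/-- `L(ℂ^d)^{⊗M}`: operators on `(ℂ^d)^{⊗M}`, as matrices in the computational basis. -/
abbrev Op (d M : ℕ) : Type := Matrix (Idx d M) (Idx d M) ℂ

/-- Unit vectors of `ℂ^d` with the Euclidean norm, representing the pure states. -/
abbrev PureState (d : ℕ) : Type := Metric.sphere (0 : EuclideanSpace ℂ (Fin d)) 1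

/-- The projector `|ψ⟩⟨ψ|`. -/
def ketbra {d : ℕ} (ψ : PureState d) : Matrix (Fin d) (Fin d) ℂ :=
  Matrix.of fun a b => ψ.1 a * star (ψ.1 b)

/-- The tensor power `A^{⊗M}` of an operator on `ℂ^d`. -/
def tensorPow {d : ℕ} (M : ℕ) (A : Matrix (Fin d) (Fin d) ℂ) : Op d M :=
  Matrix.of fun i j => ∏ s, A (i s) (j s)

/-- The tensor product `A ⊗ B` of operators on the first `N` and on the last `K` systems. -/
def opTensor {d N K : ℕ} (A : Op d N) (B : Op d K) : Op d (N + K) :=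
  Matrix.of fun i j =>
    A (fun s => i (Fin.castAdd K s)) (fun s => j (Fin.castAdd K s)) *
      B (fun s => i (Fin.natAdd N s)) (fun s => j (Fin.natAdd N s))

/-- The partial trace over the first `N` of `N + K` systems. -/
def ptraceFirst {d N K : ℕ} (X : Op d (N + K)) : Op d K :=
  Matrix.of fun a b => ∑ c : Idx d N, X (Fin.append c a) (Fin.append c b)

/-- The symmetric subspace of `(ℂ^d)^{⊗M}`: the vectors fixed by all permutations of the
tensor factors. -/
def symSubspace (d M : ℕ) : Submodule ℂ (EuclideanSpace ℂ (Idx d M)) where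
  carrier := {v | ∀ (π : Equiv.Perm (Fin M)) (i : Idx d M), v (fun s => i (π s)) = v i}
  zero_mem' := fun _ _ => rfl
  add_mem' := fun {v w} hv hw π i => by
    simp only [Set.mem_ofPred_eq] at hv hw
    simp [hv π i, hw π i]
  smul_mem' := fun c v hv π i => by
    simp only [Set.mem_ofPred_eq] at hv
    simp [hv π i]

/-- `d_S^M`, the dimension of the symmetric subspace of `(ℂ^d)^{⊗M}`. -/
noncomputable def dS (d M : ℕ) : ℕ := Module.finrank ℂ (symSubspace d M)

/-- The orthogonal projector onto the symmetric subspace, as a matrix. -/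
noncomputable def symProj (d M : ℕ) : Op d M :=
  Matrix.toEuclideanLin.symm ((symSubspace d M).starProjection : _ →ₗ[ℂ] _)

/-- Membership in `L(sym^M(ℂ^d))`: the operator is supported on the symmetric subspace. -/
def IsSymOp {d M : ℕ} (ρ : Op d M) : Prop := symProj d M * ρ * symProj d M = ρ

/-- The uniform (Haar-induced) probability distribution over pure states: the normalized
surface measure of the unit sphere. -/
noncomputable def haar (d : ℕ) : Measure (PureState d) :=
  ((volume : Measure (EuclideanSpace ℂ (Fin d))).toSphere Set.univ)⁻¹ •
    (volume : Measure (EuclideanSpace ℂ (Fin d))).toSphere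

/-- Complete positivity: `id_k ⊗ Φ` preserves positive semidefiniteness for every `k`. -/
def IsCP {n m : Type*} (Φ : Matrix n n ℂ →ₗ[ℂ] Matrix m m ℂ) : Prop :=
  ∀ (k : ℕ) (X : Matrix (Fin k × n) (Fin k × n) ℂ), X.PosSemidef →
    (Matrix.of fun p q : Fin k × m =>
      Φ (Matrix.of fun a b => X (p.1, a) (q.1, b)) p.2 q.2).PosSemidef

/-- Quantum channels: completely positive trace-preserving linear maps. -/
structure IsCPTP {n m : Type*} [Fintype n] [Fintype m]
    (Φ : Matrix n n ℂ →ₗ[ℂ] Matrix m m ℂ) : Prop where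
  cp : IsCP Φ
  tp : ∀ ρ, (Φ ρ).trace = ρ.trace

/-- `F(ρ, σ) = Tr(ρ σ)` for a pure state `σ` (a real number when `ρ` is a state). -/
noncomputable def fidelity {n : Type*} [Fintype n] (ρ σ : Matrix n n ℂ) : ℝ :=
  (ρ * σ).trace.re

/-- The average over pure states of `F(C(ψ^{⊗N}), (ψ^T)^{⊗K})`. -/
noncomputable def avgFidelity {d N K : ℕ} (C : Op d N → Op d K) : ℝ :=
  ∫ ψ, fidelity (C (tensorPow N (ketbra ψ))) (tensorPow K (ketbra ψ).transpose) ∂(haar d)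

/-- The map `ρ ↦ d_S^N ∫ dψ Tr[ρ ψ^{⊗N}] (ψ^T)^{⊗K}`; the operator-valued integral is taken
entrywise. -/
noncomputable def TCP (d N K : ℕ) (ρ : Op d N) : Op d K :=
  Matrix.of fun i j => (dS d N : ℂ) *
    ∫ ψ, (ρ * tensorPow N (ketbra ψ)).trace * tensorPow K (ketbra ψ).transpose i j ∂(haar d)

/-- `T` is the estimation (measure-and-prepare) strategy on the operators supported on the range
of the projector `P`, which measures the POVM with density `E` with respect to `μ` (a resolution
of `P`) and prepares the state `σ ω` upon the outcome `ω`. -/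
structure IsEstimation {n m Ω : Type*} [Fintype n] [Fintype m] [MeasurableSpace Ω]
    (P : Matrix n n ℂ) (μ : Measure Ω) (E : Ω → Matrix n n ℂ) (σ : Ω → Matrix m m ℂ)
    (T : Matrix n n ℂ → Matrix m m ℂ) : Prop where
  povm_pos : ∀ ω, (E ω).PosSemidef
  povm_integrable : ∀ i j, Integrable (fun ω => E ω i j) μ
  povm_complete : ∀ i j, ∫ ω, E ω i j ∂μ = P i j
  prep_measurable : ∀ i j, Measurable fun ω => σ ω i j
  prep_pos : ∀ ω, (σ ω).PosSemidef
  prep_trace : ∀ ω, (σ ω).trace = 1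
  apply_eq : ∀ ρ, P * ρ * P = ρ → ∀ i j, T ρ i j = ∫ ω, (E ω * ρ).trace * σ ω i j ∂μ

end QTranspose

namespace QTranspose

/-! Everything rests on the moment formula `integral_tensorPow_ketbra`: the mean of `ψ^{⊗M}` is the
symmetric projector divided by `d_S^M`. Unitary invariance and transitivity on unit vectors make the
expectation of this mean in `φ^{⊗M}` a constant times `‖φ‖^{2M}`. Such expectations determine an
operator on the symmetric subspace (`eq_zero_of_expect_eq_zero`, by polarization), so the mean is a
multiple of the projector, and the trace fixes the factor.

Upper bound: let `J` be the Choi operator of a channel. The transpose in the target state cancels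
the one in the Choi pairing, so the fidelity at `ψ` is `Tr[Jᵀ ψ^{⊗(N+K)}]`, with mean `Tr[Jᵀ
Π^{(N+K)}] / d_S^{N+K}`. Since `Π^{(N+K)} ≤ Π^{(N)} ⊗ 1` and `Jᵀ ≥ 0`, trace preservation bounds the
numerator by `Tr Π^{(N)} = d_S^N`.

Attainment: for the estimation strategy the integrand of the fidelity at `φ` is `|⟨φ|ψ⟩|^{2(N+K)}`,
and the moment formula evaluates it to the same ratio for every `φ`. A term supported off the
symmetric subspace completes the strategy to a channel. -/

/-! ### Unitary invariance of the measure on pure states -/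

theorem measure_image_linearIsometryEquiv {E : Type*} [NormedAddCommGroup E] [NormedSpace ℝ E]
    [FiniteDimensional ℝ E] [MeasurableSpace E] [BorelSpace E] (μ : Measure E)
    [μ.IsAddHaarMeasure] (U : E ≃ₗᵢ[ℝ] E) (s : Set E) : μ (U '' s) = μ s := by
  have key : ∀ t : Set E, μ (U '' t) =
      ENNReal.ofReal |LinearMap.det (U.toLinearEquiv : E →ₗ[ℝ] E)| * μ t := fun t =>
    Measure.addHaar_image_linearMap μ (U.toLinearEquiv : E →ₗ[ℝ] E) t
  -- The isometry maps the unit ball onto itself, and the ball has finite nonzero measure, so the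
  -- determinant factor is 1.
  have hb := key (Metric.ball 0 1)
  rw [LinearIsometryEquiv.image_ball, map_zero] at hb
  have h0 : μ (Metric.ball 0 1) ≠ 0 := (Metric.measure_ball_pos μ _ one_pos).ne'
  have h1 : μ (Metric.ball 0 1) ≠ ⊤ := measure_ball_lt_top.ne
  have hdet : ENNReal.ofReal |LinearMap.det (U.toLinearEquiv : E →ₗ[ℝ] E)| = 1 := by
    have := (ENNReal.mul_left_inj h0 h1).1 ((one_mul _).trans hb)
    exact this.symm
  rw [key, hdet, one_mul]

/-- The action of a unitary on pure states. -/
noncomputable def unitaryAct {d : ℕ} (U : EuclideanSpace ℂ (Fin d) ≃ₗᵢ[ℂ] EuclideanSpace ℂ (Fin d))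
    (ψ : PureState d) : PureState d :=
  ⟨U ψ.1, by simp⟩

theorem continuous_unitaryAct {d : ℕ}
    (U : EuclideanSpace ℂ (Fin d) ≃ₗᵢ[ℂ] EuclideanSpace ℂ (Fin d)) :
    Continuous (unitaryAct U) :=
  Continuous.subtype_mk (U.continuous.comp continuous_subtype_val) _

theorem map_unitaryAct_toSphere {d : ℕ}
    (U : EuclideanSpace ℂ (Fin d) ≃ₗᵢ[ℂ] EuclideanSpace ℂ (Fin d)) :
    ((volume : Measure (EuclideanSpace ℂ (Fin d))).toSphere).map (unitaryAct U) =
      (volume : Measure (EuclideanSpace ℂ (Fin d))).toSphere := by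
  ext s hs
  have hm := (continuous_unitaryAct U).measurable
  rw [Measure.map_apply hm hs, Measure.toSphere_apply' _ (hm hs), Measure.toSphere_apply' _ hs]
  congr 1
  -- The surface measure of a set is read off from the volume of the cone over it. As a real
  -- isometry, `U` carries the cone over the preimage of `s` onto the cone over `s`.
  let V : EuclideanSpace ℂ (Fin d) ≃ₗᵢ[ℝ] EuclideanSpace ℂ (Fin d) :=
    { U.toLinearEquiv.restrictScalars ℝ with norm_map' := U.norm_map }
  have hV : ∀ x, V x = U x := fun _ => rfl
  rw [← measure_image_linearIsometryEquiv volume V]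
  congr 1
  ext x
  simp only [Set.mem_image, Set.mem_smul, hV]
  constructor
  · rintro ⟨_, ⟨r, hr, _, ⟨ψ, hψ, rfl⟩, rfl⟩, rfl⟩
    exact ⟨r, hr, _, ⟨_, hψ, rfl⟩, ((V.toLinearEquiv.map_smul r ψ.1)).symm⟩
  · rintro ⟨r, hr, _, ⟨ψ, hψ, rfl⟩, rfl⟩
    refine ⟨_, ⟨r, hr, _, ⟨unitaryAct U.symm ψ, ?_, rfl⟩, rfl⟩, ?_⟩
    · have : unitaryAct U (unitaryAct U.symm ψ) = ψ := Subtype.ext (U.apply_symm_apply _)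
      simpa [this] using hψ
    · refine (V.toLinearEquiv.map_smul r _).trans ?_
      congr 1
      exact U.apply_symm_apply _

theorem map_unitaryAct_haar {d : ℕ}
    (U : EuclideanSpace ℂ (Fin d) ≃ₗᵢ[ℂ] EuclideanSpace ℂ (Fin d)) :
    (haar d).map (unitaryAct U) = haar d := by
  rw [haar, Measure.map_smul, map_unitaryAct_toSphere]

theorem integral_unitaryAct {d : ℕ}
    (U : EuclideanSpace ℂ (Fin d) ≃ₗᵢ[ℂ] EuclideanSpace ℂ (Fin d)) {f : PureState d → ℂ}
    (hf : Continuous f) :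
    ∫ ψ, f (unitaryAct U ψ) ∂(haar d) = ∫ ψ, f ψ ∂(haar d) := by
  conv_rhs => rw [← map_unitaryAct_haar U]
  rw [integral_map (continuous_unitaryAct U).aemeasurable hf.aestronglyMeasurable]

theorem isProbabilityMeasure_haar {d : ℕ} (hd : 1 ≤ d) : IsProbabilityMeasure (haar d) := by
  have : Nonempty (Fin d) := ⟨⟨0, hd⟩⟩
  refine ⟨?_⟩
  rw [haar, Measure.smul_apply, smul_eq_mul]
  refine ENNReal.inv_mul_cancel ?_ (measure_ne_top _ _)
  rw [Ne, Measure.measure_univ_eq_zero]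
  exact Measure.toSphere_ne_zero _

/-- The unitary group acts transitively on unit vectors. -/
theorem exists_unitary_apply_eq {d : ℕ} (φ χ : PureState d) :
    ∃ U : EuclideanSpace ℂ (Fin d) ≃ₗᵢ[ℂ] EuclideanSpace ℂ (Fin d), U φ.1 = χ.1 := by
  rcases Nat.eq_zero_or_pos d with rfl | hd
  · exact ⟨.refl _ _, Subsingleton.elim _ _⟩
  -- Any unit vector starts some orthonormal basis; the unitary matching two such bases does the
  -- job.
  have hex : ∀ φ : PureState d,
      ∃ b : OrthonormalBasis (Fin d) ℂ (EuclideanSpace ℂ (Fin d)), b ⟨0, hd⟩ = φ.1 := by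
    intro φ
    have hn : ‖φ.1‖ = 1 := by simp
    have ho : Orthonormal ℂ (({⟨0, hd⟩} : Set (Fin d)).domRestrict (fun _ => φ.1)) := by
      refine ⟨fun i => hn, fun i j hij => (hij (Subsingleton.elim _ _)).elim⟩
    obtain ⟨b, hb⟩ := ho.exists_orthonormalBasis_extension_of_card_eq (by simp)
    exact ⟨b, hb _ rfl⟩
  obtain ⟨b, hb⟩ := hex φ
  obtain ⟨b', hb'⟩ := hex χ
  refine ⟨b.equiv b' (Equiv.refl _), ?_⟩
  rw [← hb, ← hb']
  simp

instance compactSpace_pureState (d : ℕ) : CompactSpace (PureState d) :=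
  isCompact_iff_compactSpace.1 (isCompact_sphere _ _)

theorem integrable_of_continuous {d : ℕ} (hd : 1 ≤ d) {f : PureState d → ℂ} (hf : Continuous f) :
    Integrable f (haar d) := by
  have := isProbabilityMeasure_haar hd
  exact hf.integrable_of_hasCompactSupport (HasCompactSupport.of_compactSpace f)

/-! ### Dimension of the symmetric subspace -/

open Matrix

/-- The multiset of letters of a string. -/
def letters {d M : ℕ} (i : Idx d M) : Sym (Fin d) M :=
  ⟨Finset.univ.val.map i, by simp⟩

theorem letters_comp_perm {d M : ℕ} (i : Idx d M) (π : Equiv.Perm (Fin M)) :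
    letters (fun s => i (π s)) = letters i := by
  apply Subtype.ext
  change Multiset.map (i ∘ π) Finset.univ.val = Multiset.map i Finset.univ.val
  rw [← Multiset.map_map]
  congr 1
  exact congrArg Finset.val (Finset.map_univ_equiv π)

/-- Equal multiplicities give a bijection between the positions of each letter; these bijections
glue to a permutation of all positions. -/
theorem exists_perm_of_letters_eq {d M : ℕ} {i j : Idx d M} (h : letters i = letters j) :
    ∃ π : Equiv.Perm (Fin M), (fun s => i (π s)) = j := by
  have hc : ∀ a : Fin d, Fintype.card {s // j s = a} = Fintype.card {s // i s = a} := by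
    intro a
    have := congrArg (fun x : Sym (Fin d) M => Multiset.count a x.1) h
    simp only [letters, Multiset.count_map] at this
    rw [Fintype.card_subtype, Fintype.card_subtype]
    simp only [Finset.card, Finset.filter_val]
    simp only [eq_comm (b := a)]
    exact this.symm
  have e : ∀ a : Fin d, {s // j s = a} ≃ {s // i s = a} := fun a => Fintype.equivOfCardEq (hc a)
  refine ⟨Equiv.ofFiberEquiv e, funext fun s => ?_⟩
  exact Equiv.ofFiberEquiv_map e s

theorem letters_surjective (d M : ℕ) :
    Function.Surjective (letters : Idx d M → Sym (Fin d) M) := by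
  rintro ⟨m, hm⟩
  induction m using Quotient.inductionOn with
  | h l =>
    have hl : l.length = M := by simpa using hm
    subst hl
    refine ⟨l.get, Subtype.ext ?_⟩
    change Multiset.map l.get Finset.univ.val = (l : Multiset (Fin d))
    rw [Fin.univ_def]
    simp

/-- The symmetric tensor with prescribed value at each multiset of letters. -/
noncomputable def symTensor (d M : ℕ) : (Sym (Fin d) M → ℂ) →ₗ[ℂ] symSubspace d M where
  toFun := fun f => ⟨WithLp.toLp 2 fun i => f (letters i), fun π i => by
    change f (letters fun s => i (π s)) = f (letters i)
    rw [letters_comp_perm]⟩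
  map_add' := fun _ _ => rfl
  map_smul' := fun _ _ => rfl

/-- The permutation orbits of strings are exactly the fibres of `letters`, so a symmetric tensor is
a free choice of one value per multiset. -/
theorem symTensor_bijective (d M : ℕ) : Function.Bijective (symTensor d M) := by
  constructor
  · intro f g h
    funext m
    obtain ⟨i, rfl⟩ := letters_surjective d M m
    exact congrArg (fun v : symSubspace d M => v.1 i) h
  · rintro ⟨v, hv⟩
    refine ⟨fun m => v (Function.surjInv (letters_surjective d M) m), Subtype.ext ?_⟩
    ext i
    change v (Function.surjInv (letters_surjective d M) (letters i)) = v i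
    obtain ⟨π, hπ⟩ := exists_perm_of_letters_eq
      (Function.surjInv_eq (letters_surjective d M) (letters i))
    have h := hv π (Function.surjInv (letters_surjective d M) (letters i))
    rw [hπ] at h
    exact h.symm

theorem dS_eq_multichoose (d M : ℕ) : dS d M = d.multichoose M := by
  rw [dS, ← (LinearEquiv.ofBijective _ (symTensor_bijective d M)).finrank_eq, Module.finrank_fintype_fun_eq_card,
    Sym.card_sym_eq_multichoose, Fintype.card_fin]

theorem dS_eq_choose {d : ℕ} (hd : 1 ≤ d) (M : ℕ) : dS d M = (M + d - 1).choose (d - 1) := by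
  rw [dS_eq_multichoose, Nat.multichoose_eq, add_comm d M]
  apply Nat.choose_symm_of_eq_add
  omega

theorem dS_pos {d : ℕ} (hd : 1 ≤ d) (M : ℕ) : 0 < dS d M := by
  rw [dS_eq_choose hd]
  exact Nat.choose_pos (by omega)

/-! ### The symmetric projector as an average over permutations -/

/-- The average of the permutation operators. -/
noncomputable def permAvg (d M : ℕ) : Op d M :=
  Matrix.of fun i j =>
    (M.factorial : ℂ)⁻¹ * ∑ π : Equiv.Perm (Fin M), if (fun s => i (π s)) = j then 1 else 0

theorem permAvg_mulVec {d M : ℕ} (v : Idx d M → ℂ) (i : Idx d M) :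
    (permAvg d M *ᵥ v) i =
      (M.factorial : ℂ)⁻¹ * ∑ π : Equiv.Perm (Fin M), v (fun s => i (π s)) := by
  simp only [Matrix.mulVec, dotProduct, permAvg, Matrix.of_apply, mul_assoc, Finset.sum_mul,
    ← Finset.mul_sum]
  rw [Finset.sum_comm]
  simp

theorem permAvg_comm {d M : ℕ} (i j : Idx d M) : permAvg d M i j = permAvg d M j i := by
  simp only [permAvg, Matrix.of_apply]
  congr 1
  rw [← Equiv.sum_comp (Equiv.inv (Equiv.Perm (Fin M)))]
  refine Finset.sum_congr rfl fun π _ => ?_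
  congr 1
  apply propext
  simp only [Equiv.inv_apply]
  constructor
  · rintro rfl
    simp
  · rintro rfl
    simp

theorem star_permAvg {d M : ℕ} (i j : Idx d M) : star (permAvg d M i j) = permAvg d M i j := by
  simp only [permAvg, Matrix.of_apply, star_mul', star_inv₀, star_sum, star_natCast]
  congr 1
  refine Finset.sum_congr rfl fun π _ => ?_
  split_ifs <;> simp

theorem permAvg_mulVec_of_symm {d M : ℕ} {v : Idx d M → ℂ}
    (hv : ∀ (π : Equiv.Perm (Fin M)) (i : Idx d M), v (fun s => i (π s)) = v i) :
    permAvg d M *ᵥ v = v := by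
  funext i
  rw [permAvg_mulVec]
  simp only [hv, Finset.sum_const, Finset.card_univ, Fintype.card_perm, Fintype.card_fin,
    nsmul_eq_mul]
  rw [inv_mul_cancel_left₀]
  exact_mod_cast M.factorial_ne_zero

theorem permAvg_mulVec_symm {d M : ℕ} (v : Idx d M → ℂ) (σ : Equiv.Perm (Fin M))
    (i : Idx d M) : (permAvg d M *ᵥ v) (fun s => i (σ s)) = (permAvg d M *ᵥ v) i := by
  rw [permAvg_mulVec, permAvg_mulVec]
  congr 1
  exact Equiv.sum_comp (Equiv.mulLeft σ) fun π => v fun s => i (π s)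

/-- The average has symmetric values, fixes symmetric vectors and is Hermitian, which makes the
residual of `u` orthogonal to every symmetric `w`. This gives explicit entries, real and symmetric
in the two indices. -/
theorem symProj_eq_permAvg (d M : ℕ) : symProj d M = permAvg d M := by
  rw [symProj, LinearEquiv.symm_apply_eq]
  ext1 u
  change (symSubspace d M).starProjection u = _
  apply Submodule.eq_starProjection_of_mem_of_inner_eq_zero
  · intro π i
    exact permAvg_mulVec_symm _ π i
  · intro w hw
    have hw' : permAvg d M *ᵥ w.ofLp = w.ofLp := permAvg_mulVec_of_symm hw
    rw [inner_sub_left, sub_eq_zero, EuclideanSpace.inner_eq_star_dotProduct,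
      EuclideanSpace.inner_eq_star_dotProduct]
    change w.ofLp ⬝ᵥ star u.ofLp = w.ofLp ⬝ᵥ star (permAvg d M *ᵥ u.ofLp)
    have hH : (permAvg d M)ᴴ = permAvg d M := by
      ext i j
      rw [Matrix.conjTranspose_apply, star_permAvg, permAvg_comm]
    rw [Matrix.star_mulVec, hH, dotProduct_comm w.ofLp (_ ᵥ* _), ← Matrix.dotProduct_mulVec, hw',
      dotProduct_comm]

theorem symProj_comm {d M : ℕ} (i j : Idx d M) : symProj d M i j = symProj d M j i := by
  rw [symProj_eq_permAvg, permAvg_comm]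

theorem symProj_isHermitian (d M : ℕ) : (symProj d M).IsHermitian := by
  ext i j
  rw [Matrix.conjTranspose_apply, symProj_eq_permAvg, star_permAvg, permAvg_comm]

theorem symProj_mulVec_of_symm {d M : ℕ} {v : Idx d M → ℂ}
    (hv : ∀ (π : Equiv.Perm (Fin M)) (i : Idx d M), v (fun s => i (π s)) = v i) :
    symProj d M *ᵥ v = v := by
  rw [symProj_eq_permAvg, permAvg_mulVec_of_symm hv]

theorem symProj_mulVec_symm {d M : ℕ} (v : Idx d M → ℂ) (σ : Equiv.Perm (Fin M))
    (i : Idx d M) : (symProj d M *ᵥ v) (fun s => i (σ s)) = (symProj d M *ᵥ v) i := by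
  rw [symProj_eq_permAvg, permAvg_mulVec_symm]

theorem symProj_apply_perm_left {d M : ℕ} (σ : Equiv.Perm (Fin M)) (i j : Idx d M) :
    symProj d M (fun s => i (σ s)) j = symProj d M i j := by
  have := symProj_mulVec_symm (Pi.single j 1) σ i
  simpa using this

theorem symProj_apply_perm_right {d M : ℕ} (σ : Equiv.Perm (Fin M)) (i j : Idx d M) :
    symProj d M i (fun s => j (σ s)) = symProj d M i j := by
  rw [symProj_comm, symProj_apply_perm_left, symProj_comm]

/-- Operators whose columns are symmetric are fixed by the symmetric projector. -/
theorem symProj_mul_of_symm {d M : ℕ} {n : Type*} {A : Matrix (Idx d M) n ℂ}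
    (hA : ∀ (π : Equiv.Perm (Fin M)) (i : Idx d M) (j : n), A (fun s => i (π s)) j = A i j) :
    symProj d M * A = A := by
  ext i j
  exact congrFun (symProj_mulVec_of_symm (v := fun i => A i j) fun π i => hA π i j) i

theorem symProj_mul_self (d M : ℕ) : symProj d M * symProj d M = symProj d M :=
  symProj_mul_of_symm symProj_apply_perm_left

theorem trace_symProj (d M : ℕ) : (symProj d M).trace = dS d M := by
  have hp : LinearMap.IsProj (symSubspace d M)
      ((symSubspace d M).starProjection : _ →ₗ[ℂ] _) :=
    ⟨fun x => by simp, fun x hx => Submodule.starProjection_eq_self_iff.2 hx⟩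
  rw [dS, ← hp.trace, LinearMap.trace_eq_matrix_trace ℂ (PiLp.basisFun 2 ℂ (Idx d M))]
  rfl

theorem posSemidef_of_isHermitian_of_mul_self {n : Type*} [Fintype n] {P : Matrix n n ℂ}
    (h : P.IsHermitian) (hP : P * P = P) : P.PosSemidef := by
  have := Matrix.posSemidef_conjTranspose_mul_self P
  rwa [h.eq, hP] at this

/-! ### Symmetric operators are determined by expectations in product vectors -/

theorem letters_eq_of_sum_single_eq {d M : ℕ} {i j : Idx d M}
    (h : ∑ s, Finsupp.single (i s) 1 = (∑ s, Finsupp.single (j s) 1 : Fin d →₀ ℕ)) :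
    letters i = letters j := by
  have h' := congrArg Finsupp.toMultiset h
  simp only [map_sum, Finsupp.toMultiset_single, one_smul] at h'
  apply Subtype.ext
  change Multiset.map i Finset.univ.val = Multiset.map j Finset.univ.val
  have key : ∀ i : Idx d M, ∑ s, ({i s} : Multiset (Fin d)) = Multiset.map i Finset.univ.val := by
    intro i
    rw [Finset.sum, ← Multiset.sum_map_singleton (Multiset.map i _), Multiset.map_map]
    rfl
  rwa [key, key] at h'

/-- The powers `z^{⊗M}` span the symmetric tensors. -/
theorem eq_zero_of_sum_mul_prod_eq_zero {d M : ℕ} {v : Idx d M → ℂ}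
    (hv : ∀ (π : Equiv.Perm (Fin M)) (i : Idx d M), v (fun s => i (π s)) = v i)
    (h : ∀ z : Fin d → ℂ, ∑ i, v i * ∏ s, z (i s) = 0) : v = 0 := by
  -- A polynomial vanishing at every point of `ℂ^d` is the zero polynomial.
  have hp : ∑ i, MvPolynomial.monomial (∑ s, Finsupp.single (i s) 1) (v i) = 0 := by
    apply MvPolynomial.funext
    intro z
    rw [map_zero, ← h z, map_sum]
    refine Finset.sum_congr rfl fun i _ => ?_
    rw [← mul_one (v i), ← MvPolynomial.C_mul_monomial, MvPolynomial.monomial_sum_one, map_mul,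
      MvPolynomial.eval_C, map_prod, mul_one]
    simp [MvPolynomial.eval_monomial]
  funext i₀
  have hc := congrArg (MvPolynomial.coeff (∑ s, Finsupp.single (i₀ s) 1)) hp
  rw [MvPolynomial.coeff_sum, MvPolynomial.coeff_zero] at hc
  -- Only the rearrangements of `i₀` contribute to this coefficient, each with the same value `v
  -- i₀`; hence a positive multiple of `v i₀` is zero.
  have hterm : ∀ i : Idx d M, MvPolynomial.coeff (∑ s, Finsupp.single (i₀ s) 1)
      (MvPolynomial.monomial (∑ s, Finsupp.single (i s) 1) (v i)) =
      (if (∑ s, Finsupp.single (i s) 1 : Fin d →₀ ℕ) = ∑ s, Finsupp.single (i₀ s) 1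
        then (1 : ℂ) else 0) * v i₀ := by
    intro i
    rw [MvPolynomial.coeff_monomial]
    split_ifs with hi
    · obtain ⟨π, hπ⟩ := exists_perm_of_letters_eq (letters_eq_of_sum_single_eq hi)
      rw [one_mul, ← hπ, hv]
    · rw [zero_mul]
  rw [Finset.sum_congr rfl fun i _ => hterm i, ← Finset.sum_mul, Finset.sum_boole] at hc
  refine (mul_eq_zero.1 hc).resolve_left ?_
  refine Nat.cast_ne_zero.2 (Finset.card_ne_zero.2 ?_)
  exact ⟨i₀, by simp⟩

/-- A polynomial in `z` and `star z` that vanishes identically vanishes when `z` and `star z` are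
replaced by independent variables. -/
theorem sum_prod_mul_prod_eq_zero_of_star {d M : ℕ} {B : Op d M}
    (h : ∀ z : Fin d → ℂ, ∑ i, ∑ j, (∏ s, star (z (i s))) * B i j * ∏ s, z (j s) = 0)
    (w z : Fin d → ℂ) : ∑ i, ∑ j, (∏ s, w (i s)) * B i j * ∏ s, z (j s) = 0 := by
  -- The variables `inl` and `inr` stand for the real and imaginary parts of `z`. The hypothesis
  -- says that `p` vanishes at real points, which already forces `p = 0`.
  let p : MvPolynomial (Fin d ⊕ Fin d) ℂ := ∑ i : Idx d M, ∑ j : Idx d M,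
    (∏ s, (MvPolynomial.X (Sum.inl (i s)) -
        MvPolynomial.C Complex.I * MvPolynomial.X (Sum.inr (i s)))) * MvPolynomial.C (B i j) *
      ∏ s, (MvPolynomial.X (Sum.inl (j s)) +
        MvPolynomial.C Complex.I * MvPolynomial.X (Sum.inr (j s)))
  have heval : ∀ x : Fin d ⊕ Fin d → ℂ, MvPolynomial.eval x p = ∑ i, ∑ j,
      (∏ s, (x (Sum.inl (i s)) - Complex.I * x (Sum.inr (i s)))) * B i j *
        ∏ s, (x (Sum.inl (j s)) + Complex.I * x (Sum.inr (j s))) := by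
    intro x
    simp only [p, map_sum, map_mul, map_prod, map_sub, map_add, MvPolynomial.eval_X,
      MvPolynomial.eval_C]
  have hp : p = 0 := by
    apply MvPolynomial.funext_set (fun _ => Set.range Complex.ofReal)
      fun _ => Set.infinite_range_of_injective Complex.ofReal_injective
    intro x hx
    rw [map_zero, heval, ← h fun k => x (Sum.inl k) + Complex.I * x (Sum.inr k)]
    have hreal : ∀ k, star (x k) = x k := by
      intro k
      obtain ⟨r, hr⟩ := hx k trivial
      rw [← hr]
      exact Complex.conj_ofReal r
    simp only [star_add, star_mul', hreal, Complex.star_def, Complex.conj_I]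
    simp only [neg_mul, ← sub_eq_add_neg]
  -- These complex values `x`, `y` solve `x - iy = w` and `x + iy = z`.
  have := heval (Sum.elim (fun k => (w k + z k) / 2) fun k => (z k - w k) / (2 * Complex.I))
  rw [hp, map_zero] at this
  rw [this]
  have e1 : ∀ k, w k = (w k + z k) / 2 - Complex.I * ((z k - w k) / (2 * Complex.I)) := by
    intro k
    field_simp
    ring
  have e2 : ∀ k, z k = (w k + z k) / 2 + Complex.I * ((z k - w k) / (2 * Complex.I)) := by
    intro k
    field_simp
    ring
  simp only [Sum.elim_inl, Sum.elim_inr, ← e1, ← e2]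

/-- An operator on the symmetric subspace is determined by its expectations in product states. -/
theorem eq_zero_of_expect_eq_zero {d M : ℕ} {B : Op d M}
    (hl : ∀ (π : Equiv.Perm (Fin M)) (i j : Idx d M), B (fun s => i (π s)) j = B i j)
    (hr : ∀ (π : Equiv.Perm (Fin M)) (i j : Idx d M), B i (fun s => j (π s)) = B i j)
    (h : ∀ z : Fin d → ℂ, ∑ i, ∑ j, (∏ s, star (z (i s))) * B i j * ∏ s, z (j s) = 0) :
    B = 0 := by
  -- After polarization the two sides are independent, so the spanning property applies to the
  -- column index for fixed `w`, then to the row index.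
  have h1 : ∀ w : Fin d → ℂ, (fun j => ∑ i, (∏ s, w (i s)) * B i j) = 0 := by
    intro w
    apply eq_zero_of_sum_mul_prod_eq_zero
    · intro π j
      simp only [hr]
    · intro z
      rw [← sum_prod_mul_prod_eq_zero_of_star h w z, Finset.sum_comm]
      simp only [Finset.sum_mul]
  ext i j
  refine congrFun (eq_zero_of_sum_mul_prod_eq_zero (v := fun i => B i j) (fun π i => hl π i j)
    fun w => ?_) i
  simpa only [mul_comm, Pi.zero_apply] using congrFun (h1 w) j

/-! ### Tensor powers and their mean over pure states -/

theorem tensorPow_mul {d M : ℕ} (A B : Matrix (Fin d) (Fin d) ℂ) :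
    tensorPow M A * tensorPow M B = tensorPow M (A * B) := by
  ext i j
  simp only [tensorPow, Matrix.mul_apply, Matrix.of_apply, ← Finset.prod_mul_distrib]
  rw [Finset.prod_univ_sum, Fintype.piFinset_univ]

theorem trace_tensorPow {d M : ℕ} (A : Matrix (Fin d) (Fin d) ℂ) :
    (tensorPow M A).trace = A.trace ^ M := by
  simp only [Matrix.trace, Matrix.diag, tensorPow, Matrix.of_apply]
  rw [Fintype.sum_pow]

theorem trace_ketbra {d : ℕ} (ψ : PureState d) : (ketbra ψ).trace = 1 := by
  have h : inner ℂ ψ.1 ψ.1 = (1 : ℂ) := by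
    rw [inner_self_eq_norm_sq_to_K]
    simp
  rw [← h, EuclideanSpace.inner_eq_star_dotProduct]
  rfl

theorem continuous_tensorPow_ketbra {d M : ℕ} (i j : Idx d M) :
    Continuous fun ψ : PureState d => tensorPow M (ketbra ψ) i j := by
  simp only [tensorPow, ketbra, Matrix.of_apply]
  fun_prop

theorem tensorPow_ketbra_apply {d M : ℕ} (ψ : PureState d) (i j : Idx d M) :
    tensorPow M (ketbra ψ) i j = (∏ s, ψ.1 (i s)) * ∏ s, star (ψ.1 (j s)) := by
  simp only [tensorPow, ketbra, Matrix.of_apply, Finset.prod_mul_distrib]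

theorem tensorPow_ketbra_perm_left {d M : ℕ} (ψ : PureState d) (π : Equiv.Perm (Fin M))
    (i j : Idx d M) :
    tensorPow M (ketbra ψ) (fun s => i (π s)) j = tensorPow M (ketbra ψ) i j := by
  rw [tensorPow_ketbra_apply, tensorPow_ketbra_apply, Equiv.prod_comp π fun s => ψ.1 (i s)]

theorem tensorPow_ketbra_perm_right {d M : ℕ} (ψ : PureState d) (π : Equiv.Perm (Fin M))
    (i j : Idx d M) :
    tensorPow M (ketbra ψ) i (fun s => j (π s)) = tensorPow M (ketbra ψ) i j := by
  rw [tensorPow_ketbra_apply, tensorPow_ketbra_apply,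
    Equiv.prod_comp π fun s => star (ψ.1 (j s))]

/-- `∫ |⟨φ|ψ⟩|^{2M} dψ`. -/
noncomputable def overlapMoment {d : ℕ} (M : ℕ) (φ : EuclideanSpace ℂ (Fin d)) : ℂ :=
  ∫ ψ, inner ℂ φ ψ.1 ^ M * inner ℂ ψ.1 φ ^ M ∂(haar d)

theorem overlapMoment_const {d : ℕ} (M : ℕ) (φ χ : PureState d) :
    overlapMoment M φ.1 = overlapMoment M χ.1 := by
  obtain ⟨U, hU⟩ := exists_unitary_apply_eq φ χ
  rw [overlapMoment, overlapMoment, ← hU]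
  rw [← integral_unitaryAct U (f := fun ψ => inner ℂ (U φ.1) ψ.1 ^ M * inner ℂ ψ.1 (U φ.1) ^ M)
    (by fun_prop)]
  simp only [unitaryAct, LinearIsometryEquiv.inner_map_map]

theorem overlapMoment_smul {d : ℕ} (M : ℕ) (r : ℂ) (φ : EuclideanSpace ℂ (Fin d)) :
    overlapMoment M (r • φ) = (star r * r) ^ M * overlapMoment M φ := by
  rw [overlapMoment, overlapMoment, ← integral_const_mul]
  congr 1
  funext ψ
  rw [inner_smul_left, inner_smul_right, Complex.star_def]
  ring

/-- The moment is constant on unit vectors and homogeneous under scaling, so it is a multiple of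
`‖φ‖^{2M}`. -/
theorem overlapMoment_eq {d : ℕ} (M : ℕ) (χ : PureState d) (φ : EuclideanSpace ℂ (Fin d)) :
    overlapMoment M φ = overlapMoment M χ.1 * inner ℂ φ φ ^ M := by
  obtain ⟨r, φ₀, rfl⟩ : ∃ (r : ℂ) (φ₀ : PureState d), φ = r • φ₀.1 := by
    by_cases h : φ = 0
    · exact ⟨0, χ, by simp [h]⟩
    · refine ⟨(‖φ‖ : ℂ), ⟨(‖φ‖⁻¹ : ℂ) • φ, ?_⟩, ?_⟩
      · simp [norm_smul, h]
      · rw [smul_smul, mul_inv_cancel₀ (by simpa using h), one_smul]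
  have h1 : inner ℂ φ₀.1 φ₀.1 = (1 : ℂ) := by
    rw [inner_self_eq_norm_sq_to_K]
    simp
  rw [overlapMoment_smul, overlapMoment_const M φ₀ χ, inner_smul_left, inner_smul_right, h1,
    Complex.star_def]
  ring

theorem sum_prod_mul_prod {d M : ℕ} (a b : Fin d → ℂ) :
    ∑ i : Idx d M, (∏ s, a (i s)) * ∏ s, b (i s) = (∑ k, a k * b k) ^ M := by
  simp only [← Finset.prod_mul_distrib]
  rw [Fintype.sum_pow fun k => a k * b k]

theorem sum_expect_moment {d : ℕ} (hd : 1 ≤ d) (M : ℕ) (φ : EuclideanSpace ℂ (Fin d)) :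
    ∑ i : Idx d M, ∑ j : Idx d M, (∏ s, star (φ (i s))) *
      (∫ ψ, tensorPow M (ketbra ψ) i j ∂(haar d)) * ∏ s, φ (j s) = overlapMoment M φ := by
  have hint : ∀ i j : Idx d M, Integrable (fun ψ : PureState d =>
      (∏ s, star (φ (i s))) * tensorPow M (ketbra ψ) i j * ∏ s, φ (j s)) (haar d) := fun i j =>
    integrable_of_continuous hd
      ((continuous_const.mul (continuous_tensorPow_ketbra i j)).mul continuous_const)
  simp only [← integral_const_mul, ← integral_mul_const]
  rw [overlapMoment, Finset.sum_congr rfl fun i _ => (integral_finsetSum _ fun j _ => hint i j).symm,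
    ← integral_finsetSum _ fun i _ => integrable_finsetSum _ fun j _ => hint i j]
  congr 1
  funext ψ
  rw [EuclideanSpace.inner_eq_star_dotProduct, EuclideanSpace.inner_eq_star_dotProduct]
  simp only [dotProduct, Pi.star_apply]
  rw [← sum_prod_mul_prod, ← sum_prod_mul_prod, Finset.sum_mul_sum]
  refine Finset.sum_congr rfl fun i _ => Finset.sum_congr rfl fun j _ => ?_
  rw [tensorPow_ketbra_apply]
  ring

/-- The average of `ψ^{⊗M}` over pure states is the normalized symmetric projector. -/
theorem integral_tensorPow_ketbra {d : ℕ} (hd : 1 ≤ d) (M : ℕ) (i j : Idx d M) :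
    ∫ ψ, tensorPow M (ketbra ψ) i j ∂(haar d) = (dS d M : ℂ)⁻¹ * symProj d M i j := by
  have := isProbabilityMeasure_haar hd
  -- An arbitrary reference state; its moment is the unknown constant, found at the end by comparing
  -- traces.
  let χ : PureState d := ⟨EuclideanSpace.single ⟨0, hd⟩ 1, by simp⟩
  let A : Op d M := Matrix.of fun i j => ∫ ψ, tensorPow M (ketbra ψ) i j ∂(haar d)
  have hA : A = overlapMoment M χ.1 • symProj d M := by
    rw [← sub_eq_zero]
    apply eq_zero_of_expect_eq_zero
    · intro π i j
      simp only [A, Matrix.sub_apply, Matrix.smul_apply, Matrix.of_apply,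
        tensorPow_ketbra_perm_left, symProj_apply_perm_left]
    · intro π i j
      simp only [A, Matrix.sub_apply, Matrix.smul_apply, Matrix.of_apply,
        tensorPow_ketbra_perm_right, symProj_apply_perm_right]
    · intro z
      have h1 := sum_expect_moment hd M (WithLp.toLp 2 z)
      rw [overlapMoment_eq M χ, EuclideanSpace.inner_eq_star_dotProduct] at h1
      simp only [dotProduct, Pi.star_apply] at h1
      rw [← sum_prod_mul_prod] at h1
      have h2 : ∀ i : Idx d M, ∑ j, symProj d M i j * ∏ s, z (j s) = ∏ s, z (i s) := fun i =>
        congrFun (symProj_mulVec_of_symm (v := fun i : Idx d M => ∏ s, z (i s)) fun π i =>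
          Equiv.prod_comp π fun s => z (i s)) i
      simp only [Matrix.sub_apply, mul_sub, sub_mul, Finset.sum_sub_distrib]
      rw [sub_eq_zero]
      refine h1.trans ?_
      rw [Finset.mul_sum]
      refine Finset.sum_congr rfl fun i _ => ?_
      rw [← h2 i, Finset.sum_mul, Finset.mul_sum]
      refine Finset.sum_congr rfl fun j _ => ?_
      rw [Matrix.smul_apply, smul_eq_mul]
      ring
  have htr : A.trace = 1 := by
    simp only [Matrix.trace, Matrix.diag, A, Matrix.of_apply]
    rw [← integral_finsetSum _ fun i _ =>
      integrable_of_continuous hd (continuous_tensorPow_ketbra i i)]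
    have : ∀ ψ : PureState d, ∑ i, tensorPow M (ketbra ψ) i i = 1 := fun ψ =>
      (trace_tensorPow _).trans (by rw [trace_ketbra, one_pow])
    simp [this]
  rw [hA, Matrix.trace_smul, trace_symProj, smul_eq_mul] at htr
  rw [← eq_inv_of_mul_eq_one_left htr]
  exact congrFun (congrFun hA i) j

/-! ### Positivity, complete positivity and the Choi matrix -/

theorem trace_mul_nonneg_of_projection {n : Type*} [Fintype n] {A P : Matrix n n ℂ}
    (hA : A.PosSemidef) (hP : P.IsHermitian) (hPP : P * P = P) : 0 ≤ (A * P).trace := by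
  have h := (hA.conjTranspose_mul_mul_same P).trace_nonneg
  rwa [hP.eq, Matrix.trace_mul_comm, ← Matrix.mul_assoc, hPP, Matrix.trace_mul_comm] at h

/-- Measuring a projection on the second system leaves a positive operator on the first. -/
theorem posSemidef_trace_projection_mul {κ n : Type*} [Fintype κ] [Fintype n]
    {P : Matrix n n ℂ} (hP : P.IsHermitian) (hPP : P * P = P)
    {X : Matrix (κ × n) (κ × n) ℂ} (hX : X.PosSemidef) :
    (Matrix.of fun a b : κ =>
      (P * Matrix.of fun x y => X (a, x) (b, y)).trace).PosSemidef := by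
  classical
  -- Since `P = Pᴴ P`, pairing with `P` splits into a sum over its rows, and row `c` acts as
  -- conjugation by `V c`, the identity on `κ` tensored with the conjugated row.
  let V : n → Matrix (κ × n) κ ℂ := fun c => Matrix.of fun p a =>
    if p.1 = a then star (P c p.2) else 0
  have hV : (Matrix.of fun a b : κ => (P * Matrix.of fun x y => X (a, x) (b, y)).trace) =
      ∑ c, (V c)ᴴ * X * V c := by
    ext a b
    have hs : ∀ y x, P y x = ∑ c, star (P c y) * P c x := by
      intro y x
      conv_lhs => rw [← hPP, Matrix.mul_apply]
      refine Finset.sum_congr rfl fun c _ => ?_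
      rw [hP.apply]
    have hc : ∀ c, ((V c)ᴴ * X * V c) a b =
        ∑ y, ∑ x, P c x * X (a, x) (b, y) * star (P c y) := by
      intro c
      simp only [Matrix.mul_apply, V, Matrix.conjTranspose_apply, Matrix.of_apply,
        Fintype.sum_prod_type]
      rw [Finset.sum_eq_single b (fun k _ hk => by simp [hk]) (by simp)]
      refine Finset.sum_congr rfl fun y _ => ?_
      rw [Finset.sum_eq_single a (fun k _ hk => by simp [hk]) (by simp), if_pos rfl,
        Finset.sum_mul]
      simp
    rw [Matrix.sum_apply, Finset.sum_congr rfl fun c _ => hc c]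
    simp only [Matrix.of_apply, Matrix.trace, Matrix.diag, Matrix.mul_apply]
    conv_rhs => rw [Finset.sum_comm]
    refine Finset.sum_congr rfl fun y _ => ?_
    conv_rhs => rw [Finset.sum_comm]
    refine Finset.sum_congr rfl fun x _ => ?_
    rw [hs, Finset.sum_mul]
    refine Finset.sum_congr rfl fun c _ => ?_
    ring
  rw [hV]
  exact Matrix.posSemidef_sum _ fun c _ => hX.conjTranspose_mul_mul_same _

theorem posSemidef_integral {Ω n : Type*} [MeasurableSpace Ω] {μ : Measure Ω} [Fintype n]
    {F : Ω → Matrix n n ℂ} (hF : ∀ ω, (F ω).PosSemidef)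
    (hint : ∀ i j, Integrable (fun ω => F ω i j) μ) :
    (Matrix.of fun i j => ∫ ω, F ω i j ∂μ).PosSemidef := by
  refine .of_dotProduct_mulVec_nonneg ?_ fun x => ?_
  · ext i j
    rw [Matrix.conjTranspose_apply, Matrix.of_apply, Matrix.of_apply, Complex.star_def,
      ← integral_conj]
    congr 1
    funext ω
    exact (hF ω).isHermitian.apply i j
  · have : star x ⬝ᵥ (Matrix.of fun i j => ∫ ω, F ω i j ∂μ) *ᵥ x =
        ∫ ω, star x ⬝ᵥ F ω *ᵥ x ∂μ := by
      simp only [dotProduct, Matrix.mulVec, Matrix.of_apply]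
      rw [integral_finsetSum _ fun i _ =>
        (integrable_finsetSum _ fun j _ => (hint i j).mul_const _).const_mul _]
      refine Finset.sum_congr rfl fun i _ => ?_
      rw [integral_const_mul, integral_finsetSum _ fun j _ => (hint i j).mul_const _]
      simp only [integral_mul_const]
    rw [this]
    exact integral_nonneg fun ω => (hF ω).dotProduct_mulVec_nonneg x

/-- Frees the ancilla from the form `Fin k`; the Choi matrix needs the input index type itself as
ancilla. -/
theorem IsCP.posSemidef {κ n m : Type*} [Fintype κ] {Φ : Matrix n n ℂ →ₗ[ℂ] Matrix m m ℂ}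
    (hΦ : IsCP Φ) {X : Matrix (κ × n) (κ × n) ℂ} (hX : X.PosSemidef) :
    (Matrix.of fun p q : κ × m =>
      Φ (Matrix.of fun a b => X (p.1, a) (q.1, b)) p.2 q.2).PosSemidef := by
  let e := Fintype.equivFin κ
  have h := hΦ _ _ (hX.submatrix fun p : Fin (Fintype.card κ) × n => (e.symm p.1, p.2))
  have h' := h.submatrix fun p : κ × m => (e p.1, p.2)
  convert h' using 1
  ext p q
  simp [Matrix.submatrix]

/-- The Choi matrix is the image of the unnormalized maximally entangled projector under the
amplified map. -/
theorem IsCP.choi_posSemidef {n m : Type*} [Fintype n] [DecidableEq n]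
    {Φ : Matrix n n ℂ →ₗ[ℂ] Matrix m m ℂ} (hΦ : IsCP Φ) :
    (Matrix.of fun p q : n × m => Φ (Matrix.single p.1 q.1 1) p.2 q.2).PosSemidef := by
  have h := hΦ.posSemidef
    (Matrix.posSemidef_vecMulVec_self_star fun p : n × n => if p.1 = p.2 then (1 : ℂ) else 0)
  have hs : ∀ a b : n, Matrix.single a b (1 : ℂ) = Matrix.of fun x y =>
      Matrix.vecMulVec (fun p : n × n => if p.1 = p.2 then (1 : ℂ) else 0)
        (star fun p : n × n => if p.1 = p.2 then (1 : ℂ) else 0) (a, x) (b, y) := by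
    intro a b
    ext x y
    simp only [Matrix.single_apply, Matrix.vecMulVec_apply, Matrix.of_apply, Pi.star_apply]
    split_ifs <;> simp_all
  simpa only [hs] using h

theorem isCP_add {n m : Type*} {Φ Ψ : Matrix n n ℂ →ₗ[ℂ] Matrix m m ℂ}
    (hΦ : IsCP Φ) (hΨ : IsCP Ψ) : IsCP (Φ + Ψ) := fun k X hX =>
  (hΦ k X hX).add (hΨ k X hX)

/-! ### Powers of pure states as projectors on the symmetric subspace -/

theorem tensorPow_ketbra_isHermitian {d : ℕ} (M : ℕ) (ψ : PureState d) :
    (tensorPow M (ketbra ψ)).IsHermitian := by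
  ext i j
  rw [Matrix.conjTranspose_apply, tensorPow_ketbra_apply, tensorPow_ketbra_apply]
  simp only [star_mul', star_prod, star_star, mul_comm]

theorem ketbra_mul_self {d : ℕ} (ψ : PureState d) : ketbra ψ * ketbra ψ = ketbra ψ := by
  ext i j
  have h : ∑ k, ψ.1 k * star (ψ.1 k) = 1 := trace_ketbra ψ
  simp only [Matrix.mul_apply, ketbra, Matrix.of_apply]
  calc ∑ k, ψ.1 i * star (ψ.1 k) * (ψ.1 k * star (ψ.1 j))
      = ∑ k, (ψ.1 k * star (ψ.1 k)) * (ψ.1 i * star (ψ.1 j)) :=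
        Finset.sum_congr rfl fun k _ => by ring
    _ = _ := by rw [← Finset.sum_mul, h, one_mul]

theorem tensorPow_ketbra_mul_self {d : ℕ} (M : ℕ) (ψ : PureState d) :
    tensorPow M (ketbra ψ) * tensorPow M (ketbra ψ) = tensorPow M (ketbra ψ) := by
  rw [tensorPow_mul, ketbra_mul_self]

theorem tensorPow_ketbra_posSemidef {d : ℕ} (M : ℕ) (ψ : PureState d) :
    (tensorPow M (ketbra ψ)).PosSemidef :=
  posSemidef_of_isHermitian_of_mul_self (tensorPow_ketbra_isHermitian M ψ)
    (tensorPow_ketbra_mul_self M ψ)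

theorem trace_tensorPow_ketbra {d : ℕ} (M : ℕ) (ψ : PureState d) :
    (tensorPow M (ketbra ψ)).trace = 1 := by
  rw [trace_tensorPow, trace_ketbra, one_pow]

theorem tensorPow_transpose_ketbra_posSemidef {d : ℕ} (M : ℕ) (ψ : PureState d) :
    (tensorPow M (ketbra ψ).transpose).PosSemidef :=
  (tensorPow_ketbra_posSemidef M ψ).transpose

theorem trace_tensorPow_transpose_ketbra {d : ℕ} (M : ℕ) (ψ : PureState d) :
    (tensorPow M (ketbra ψ).transpose).trace = 1 := by
  rw [trace_tensorPow, Matrix.trace_transpose, trace_ketbra, one_pow]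

theorem symProj_mul_tensorPow_ketbra {d : ℕ} (M : ℕ) (ψ : PureState d) :
    symProj d M * tensorPow M (ketbra ψ) = tensorPow M (ketbra ψ) :=
  symProj_mul_of_symm (tensorPow_ketbra_perm_left ψ)

theorem tensorPow_ketbra_mul_symProj {d : ℕ} (M : ℕ) (ψ : PureState d) :
    tensorPow M (ketbra ψ) * symProj d M = tensorPow M (ketbra ψ) := by
  have h := congrArg Matrix.conjTranspose (symProj_mul_tensorPow_ketbra M ψ)
  rwa [Matrix.conjTranspose_mul, (tensorPow_ketbra_isHermitian M ψ).eq,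
    (symProj_isHermitian d M).eq] at h

theorem continuous_trace_mul_tensorPow_ketbra {d M : ℕ} (B : Op d M) :
    Continuous fun ψ : PureState d => (B * tensorPow M (ketbra ψ)).trace := by
  simp only [Matrix.trace, Matrix.diag, Matrix.mul_apply]
  exact continuous_finsetSum _ fun i _ => continuous_finsetSum _ fun j _ =>
    continuous_const.mul (continuous_tensorPow_ketbra j i)

theorem integral_trace_mul_tensorPow_ketbra {d : ℕ} (hd : 1 ≤ d) {M : ℕ} (B : Op d M) :
    ∫ ψ, (B * tensorPow M (ketbra ψ)).trace ∂(haar d) =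
      (dS d M : ℂ)⁻¹ * (B * symProj d M).trace := by
  have hint : ∀ i j : Idx d M, Integrable (fun ψ : PureState d =>
      B i j * tensorPow M (ketbra ψ) j i) (haar d) := fun i j =>
    integrable_of_continuous hd (continuous_const.mul (continuous_tensorPow_ketbra j i))
  simp only [Matrix.trace, Matrix.diag, Matrix.mul_apply]
  rw [integral_finsetSum _ fun i _ => integrable_finsetSum _ fun j _ => hint i j, Finset.mul_sum]
  refine Finset.sum_congr rfl fun i _ => ?_
  rw [integral_finsetSum _ fun j _ => hint i j, Finset.mul_sum]
  refine Finset.sum_congr rfl fun j _ => ?_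
  rw [integral_const_mul, integral_tensorPow_ketbra hd]
  ring

/-! ### Splitting `N + K` systems -/

theorem sum_append {d N K : ℕ} (f : Idx d (N + K) → ℂ) :
    ∑ p, f p = ∑ c : Idx d N, ∑ a : Idx d K, f (Fin.append c a) := by
  rw [← Equiv.sum_comp (Fin.appendEquiv N K), Fintype.sum_prod_type]
  rfl

theorem symProj_append_perm {d N K : ℕ} (σ : Equiv.Perm (Fin N)) (c : Idx d N) (a : Idx d K)
    (q : Idx d (N + K)) :
    symProj d (N + K) (Fin.append (fun s => c (σ s)) a) q =
      symProj d (N + K) (Fin.append c a) q := by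
  rw [← symProj_apply_perm_left
    (finSumFinEquiv.permCongr (Equiv.sumCongr σ (Equiv.refl (Fin K)))) (Fin.append c a)]
  congr 1
  funext s
  refine Fin.addCases (fun s => ?_) (fun s => ?_) s <;> simp [Equiv.permCongr_apply]

theorem opTensor_append {d N K : ℕ} (A : Op d N) (B : Op d K) (c x : Idx d N) (a b : Idx d K) :
    opTensor A B (Fin.append c a) (Fin.append x b) = A c x * B a b := by
  simp [opTensor]

theorem opTensor_mul {d N K : ℕ} (A A' : Op d N) (B B' : Op d K) :
    opTensor A B * opTensor A' B' = opTensor (A * A') (B * B') := by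
  ext p q
  obtain ⟨⟨c, a⟩, rfl⟩ := (Fin.appendEquiv N K).surjective p
  obtain ⟨⟨x, b⟩, rfl⟩ := (Fin.appendEquiv N K).surjective q
  change (opTensor A B * opTensor A' B') (Fin.append c a) (Fin.append x b) =
    opTensor (A * A') (B * B') (Fin.append c a) (Fin.append x b)
  rw [Matrix.mul_apply, sum_append, opTensor_append, Matrix.mul_apply, Matrix.mul_apply,
    Finset.sum_mul_sum]
  refine Finset.sum_congr rfl fun y _ => Finset.sum_congr rfl fun e _ => ?_
  rw [opTensor_append, opTensor_append]
  ring

theorem opTensor_isHermitian {d N K : ℕ} {A : Op d N} {B : Op d K} (hA : A.IsHermitian)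
    (hB : B.IsHermitian) : (opTensor A B).IsHermitian := by
  ext p q
  simp only [Matrix.conjTranspose_apply, opTensor, Matrix.of_apply, star_mul', hA.apply, hB.apply]

/-- A vector symmetric in all `N + K` factors is in particular symmetric in the first `N`. -/
theorem opTensor_symProj_one_mul_symProj (d N K : ℕ) :
    opTensor (symProj d N) (1 : Op d K) * symProj d (N + K) = symProj d (N + K) := by
  ext p q
  obtain ⟨⟨c, a⟩, rfl⟩ := (Fin.appendEquiv N K).surjective p
  change (opTensor (symProj d N) (1 : Op d K) * symProj d (N + K)) (Fin.append c a) q =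
    symProj d (N + K) (Fin.append c a) q
  rw [Matrix.mul_apply, sum_append]
  simp only [opTensor_append, Matrix.one_apply, mul_ite, mul_one, mul_zero, ite_mul, zero_mul,
    Finset.sum_ite_eq, Finset.mem_univ, if_true]
  exact congrFun (symProj_mulVec_of_symm (v := fun c => symProj d (N + K) (Fin.append c a) q)
    fun σ c => symProj_append_perm σ c a q) c

/-- `Π^{(N)} ⊗ 1 - Π^{(N+K)}` is a projector. -/
theorem opTensor_symProj_one_sub_isHermitian (d N K : ℕ) :
    (opTensor (symProj d N) (1 : Op d K) - symProj d (N + K)).IsHermitian :=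
  (opTensor_isHermitian (symProj_isHermitian d N) Matrix.isHermitian_one).sub
    (symProj_isHermitian d (N + K))

/-- The two projectors are nested, so their difference is idempotent. Its positivity is the operator
inequality behind the upper bound. -/
theorem opTensor_symProj_one_sub_mul_self (d N K : ℕ) :
    (opTensor (symProj d N) (1 : Op d K) - symProj d (N + K)) *
      (opTensor (symProj d N) (1 : Op d K) - symProj d (N + K)) =
    opTensor (symProj d N) (1 : Op d K) - symProj d (N + K) := by
  have h1 := opTensor_symProj_one_mul_symProj d N K
  have h2 := congrArg Matrix.conjTranspose h1
  rw [Matrix.conjTranspose_mul, (symProj_isHermitian d (N + K)).eq,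
    (opTensor_isHermitian (symProj_isHermitian d N) (Matrix.isHermitian_one (n := Idx d K))).eq]
    at h2
  rw [sub_mul, mul_sub, mul_sub, h1, h2, opTensor_mul, symProj_mul_self, symProj_mul_self,
    one_mul, sub_self, sub_zero]

theorem trace_opTensor_mul_tensorPow {d N K : ℕ} (A : Op d N) (B : Op d K)
    (T : Matrix (Fin d) (Fin d) ℂ) :
    (opTensor A B * tensorPow (N + K) T).trace =
      (A * tensorPow N T).trace * (B * tensorPow K T).trace := by
  have h : tensorPow (N + K) T = opTensor (tensorPow N T) (tensorPow K T) := by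
    ext p q
    simp only [tensorPow, opTensor, Matrix.of_apply, Fin.prod_univ_add]
  rw [h, opTensor_mul, Matrix.trace, sum_append]
  simp only [Matrix.diag, opTensor_append]
  rw [Matrix.trace, Matrix.trace, Finset.sum_mul_sum]
  rfl

/-! ### The estimation strategy -/

/-- Transposition turns the `(i, j)` entry into the trace against the matrix unit at `(i, j)`. The
integrand thus becomes linear in `ψ^{⊗(N+K)}`, ready for the moment formula. -/
theorem trace_mul_mul_tensorPow_transpose_apply {d N K : ℕ} (ρ : Op d N) (ψ : PureState d)
    (i j : Idx d K) :
    (ρ * tensorPow N (ketbra ψ)).trace * tensorPow K (ketbra ψ).transpose i j =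
      (opTensor ρ (Matrix.single i j (1 : ℂ)) * tensorPow (N + K) (ketbra ψ)).trace := by
  rw [trace_opTensor_mul_tensorPow, Matrix.trace_single_mul, one_smul]
  rfl

theorem TCP_apply {d : ℕ} (hd : 1 ≤ d) {N K : ℕ} (ρ : Op d N) (i j : Idx d K) :
    TCP d N K ρ i j = (dS d N : ℂ) * ((dS d (N + K) : ℂ)⁻¹ *
      (opTensor ρ (Matrix.single i j (1 : ℂ)) * symProj d (N + K)).trace) := by
  rw [TCP, Matrix.of_apply, ← integral_trace_mul_tensorPow_ketbra hd]
  simp only [trace_mul_mul_tensorPow_transpose_apply]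

theorem TCP_eq_ptraceFirst {d : ℕ} (hd : 1 ≤ d) {N K : ℕ} (ρ : Op d N) :
    TCP d N K ρ = ((dS d N : ℂ) / (dS d (N + K) : ℂ)) •
      ptraceFirst (symProj d (N + K) * opTensor ρ.transpose (1 : Op d K)) := by
  ext i j
  rw [TCP_apply hd, Matrix.smul_apply, smul_eq_mul, ← mul_assoc, ← div_eq_mul_inv]
  congr 1
  simp only [ptraceFirst, Matrix.of_apply, Matrix.trace, Matrix.diag, sum_append,
    Matrix.mul_apply, opTensor_append, Matrix.one_apply, Matrix.transpose_apply]
  refine Finset.sum_congr rfl fun c _ => ?_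
  rw [Finset.sum_eq_single i (fun a _ ha => by simp [ha.symm]) (by simp)]
  refine Finset.sum_congr rfl fun x _ => ?_
  rw [Finset.sum_eq_single j (fun b _ hb => by simp [hb.symm]) (by simp),
    Finset.sum_eq_single j (fun b _ hb => by simp [hb]) (by simp)]
  -- Exchanging the indices of the real symmetric projector is what produces `ρᵀ` in the closed
  -- form.
  rw [Matrix.single_apply_same, if_pos rfl, symProj_comm]
  ring

/-- `TCP` as a linear map. -/
noncomputable def TCPLinear {d : ℕ} (hd : 1 ≤ d) (N K : ℕ) : Op d N →ₗ[ℂ] Op d K where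
  toFun := TCP d N K
  map_add' := fun ρ σ => by
    ext i j
    have h : opTensor (ρ + σ) (Matrix.single i j (1 : ℂ)) =
        opTensor ρ (Matrix.single i j (1 : ℂ)) + opTensor σ (Matrix.single i j (1 : ℂ)) := by
      ext p q
      exact add_mul _ _ _
    rw [Matrix.add_apply, TCP_apply hd, TCP_apply hd, TCP_apply hd, h, Matrix.add_mul,
      Matrix.trace_add]
    ring
  map_smul' := fun r ρ => by
    ext i j
    have h : opTensor (r • ρ) (Matrix.single i j (1 : ℂ)) =
        r • opTensor ρ (Matrix.single i j (1 : ℂ)) := by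
      ext p q
      exact mul_assoc _ _ _
    rw [RingHom.id_apply, Matrix.smul_apply, TCP_apply hd, TCP_apply hd, h, Matrix.smul_mul,
      Matrix.trace_smul, smul_eq_mul, smul_eq_mul]
    ring

theorem integrable_TCP_integrand {d : ℕ} (hd : 1 ≤ d) {N K : ℕ} (ρ : Op d N) (i j : Idx d K) :
    Integrable (fun ψ : PureState d => (ρ * tensorPow N (ketbra ψ)).trace *
      tensorPow K (ketbra ψ).transpose i j) (haar d) :=
  integrable_of_continuous hd
    ((continuous_trace_mul_tensorPow_ketbra ρ).mul (continuous_tensorPow_ketbra j i))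

theorem trace_TCP_mul {d : ℕ} (hd : 1 ≤ d) {N K : ℕ} (ρ : Op d N) (σ : Op d K) :
    (TCP d N K ρ * σ).trace = (dS d N : ℂ) *
      ∫ ψ, (ρ * tensorPow N (ketbra ψ)).trace *
        (tensorPow K (ketbra ψ).transpose * σ).trace ∂(haar d) := by
  simp only [Matrix.trace, Matrix.diag, Matrix.mul_apply (N := σ), Finset.mul_sum, ← mul_assoc]
  have hint : ∀ i j, Integrable (fun ψ : PureState d =>
      (∑ x, (ρ * tensorPow N (ketbra ψ)) x x) * tensorPow K (ketbra ψ).transpose i j * σ j i)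
      (haar d) := fun i j => (integrable_TCP_integrand hd ρ i j).mul_const _
  rw [integral_finsetSum _ fun i _ => integrable_finsetSum _ fun j _ => hint i j, Finset.mul_sum]
  refine Finset.sum_congr rfl fun i _ => ?_
  rw [integral_finsetSum _ fun j _ => hint i j, Finset.mul_sum]
  refine Finset.sum_congr rfl fun j _ => ?_
  rw [integral_mul_const, ← mul_assoc]
  rfl

theorem dS_cast_ne_zero {d : ℕ} (hd : 1 ≤ d) (M : ℕ) : (dS d M : ℂ) ≠ 0 :=
  Nat.cast_ne_zero.2 (dS_pos hd M).ne'

/-- Only the weight on the symmetric subspace survives; `discardAsymmetric` supplies the missing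
trace. -/
theorem trace_TCP {d : ℕ} (hd : 1 ≤ d) {N K : ℕ} (ρ : Op d N) :
    (TCP d N K ρ).trace = (ρ * symProj d N).trace := by
  have h := trace_TCP_mul hd ρ (1 : Op d K)
  simp only [mul_one, trace_tensorPow_transpose_ketbra] at h
  rw [h, integral_trace_mul_tensorPow_ketbra hd, mul_inv_cancel_left₀ (dS_cast_ne_zero hd N)]

/-- For each outcome `ψ` the amplified map gives the Kronecker product of a positive conditional
ancilla operator and the prepared state; integration over `ψ` keeps positivity. -/
theorem isCP_TCPLinear {d : ℕ} (hd : 1 ≤ d) (N K : ℕ) : IsCP (TCPLinear hd N K) := by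
  intro k X hX
  have h : ∀ ψ : PureState d, (Matrix.of fun p q : Fin k × Idx d K =>
      ((Matrix.of fun a b => X (p.1, a) (q.1, b)) * tensorPow N (ketbra ψ)).trace *
        tensorPow K (ketbra ψ).transpose p.2 q.2).PosSemidef := by
    intro ψ
    have h1 := (posSemidef_trace_projection_mul (tensorPow_ketbra_isHermitian N ψ)
      (tensorPow_ketbra_mul_self N ψ) hX).kronecker (tensorPow_transpose_ketbra_posSemidef K ψ)
    simp only [Matrix.trace_mul_comm (tensorPow N (ketbra ψ))] at h1
    exact h1
  have h2 := posSemidef_integral (μ := haar d) h fun p q => integrable_TCP_integrand hd _ _ _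
  exact h2.smul (Nat.cast_nonneg (dS d N) : (0 : ℂ) ≤ _)

/-- Replace the part of the input outside the symmetric subspace by the maximally mixed state. -/
noncomputable def discardAsymmetric (d N K : ℕ) : Op d N →ₗ[ℂ] Op d K where
  toFun := fun ρ => ((1 - symProj d N) * ρ).trace • ((Fintype.card (Idx d K) : ℂ)⁻¹ • 1)
  map_add' := fun ρ σ => by rw [mul_add, Matrix.trace_add, add_smul]
  map_smul' := fun r ρ => by
    rw [Matrix.mul_smul, Matrix.trace_smul, RingHom.id_apply, smul_assoc]

theorem isCP_discardAsymmetric (d N K : ℕ) : IsCP (discardAsymmetric d N K) := by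
  intro k X hX
  have hH : (1 - symProj d N).IsHermitian := Matrix.isHermitian_one.sub (symProj_isHermitian d N)
  have hP : (1 - symProj d N) * (1 - symProj d N) = 1 - symProj d N := by
    rw [sub_mul, one_mul, mul_sub, mul_one, symProj_mul_self, sub_self, sub_zero]
  have h0 : (0 : ℂ) ≤ (Fintype.card (Idx d K) : ℂ)⁻¹ := by
    rw [← Complex.ofReal_natCast, ← Complex.ofReal_inv]
    exact Complex.zero_le_real.2 (by positivity)
  exact (posSemidef_trace_projection_mul hH hP hX).kronecker
    ((Matrix.PosSemidef.one (n := Idx d K) (R := ℂ)).smul h0)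

/-- The estimation channel on all of `L(ℂ^d)^{⊗N}`. -/
noncomputable def estimationChannel {d : ℕ} (hd : 1 ≤ d) (N K : ℕ) : Op d N →ₗ[ℂ] Op d K :=
  TCPLinear hd N K + discardAsymmetric d N K

theorem isCPTP_estimationChannel {d : ℕ} (hd : 1 ≤ d) (N K : ℕ) :
    IsCPTP (estimationChannel hd N K) where
  cp := isCP_add (isCP_TCPLinear hd N K) (isCP_discardAsymmetric d N K)
  tp := fun ρ => by
    have : Nonempty (Fin d) := ⟨⟨0, hd⟩⟩
    change (TCP d N K ρ + ((1 - symProj d N) * ρ).trace •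
      ((Fintype.card (Idx d K) : ℂ)⁻¹ • (1 : Op d K))).trace = _
    rw [Matrix.trace_add, trace_TCP hd, Matrix.trace_smul, Matrix.trace_smul, Matrix.trace_one,
      smul_eq_mul, smul_eq_mul, inv_mul_cancel₀ (Nat.cast_ne_zero.2 Fintype.card_ne_zero), mul_one,
      sub_mul, one_mul, Matrix.trace_sub, Matrix.trace_mul_comm (symProj d N)]
    ring

theorem estimationChannel_eq_TCP {d : ℕ} (hd : 1 ≤ d) {N K : ℕ} {ρ : Op d N}
    (hρ : IsSymOp ρ) : estimationChannel hd N K ρ = TCP d N K ρ := by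
  have h : (1 - symProj d N) * ρ = 0 := by
    have h' : symProj d N * ρ = ρ := by
      conv_rhs => rw [← hρ]
      conv_lhs => rw [← hρ]
      rw [← Matrix.mul_assoc, ← Matrix.mul_assoc, symProj_mul_self]
    rw [sub_mul, one_mul, h', sub_self]
  change TCP d N K ρ + ((1 - symProj d N) * ρ).trace • _ = _
  rw [h, Matrix.trace_zero, zero_smul, add_zero]

theorem isSymOp_tensorPow_ketbra {d : ℕ} (N : ℕ) (ψ : PureState d) :
    IsSymOp (tensorPow N (ketbra ψ)) := by
  rw [IsSymOp, symProj_mul_tensorPow_ketbra, tensorPow_ketbra_mul_symProj]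

/-- The overlaps from measuring and from preparing multiply to the `(N+K)`-th power of a single
overlap, and `φ^{⊗(N+K)}` lies in the symmetric subspace. -/
theorem trace_TCP_tensorPow_mul {d : ℕ} (hd : 1 ≤ d) (N K : ℕ) (φ : PureState d) :
    (TCP d N K (tensorPow N (ketbra φ)) * tensorPow K (ketbra φ).transpose).trace =
      (dS d N : ℂ) / (dS d (N + K) : ℂ) := by
  rw [trace_TCP_mul hd]
  have h : ∀ ψ : PureState d, (tensorPow N (ketbra φ) * tensorPow N (ketbra ψ)).trace *
      (tensorPow K (ketbra ψ).transpose * tensorPow K (ketbra φ).transpose).trace =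
      (tensorPow (N + K) (ketbra φ) * tensorPow (N + K) (ketbra ψ)).trace := by
    intro ψ
    rw [tensorPow_mul, tensorPow_mul, tensorPow_mul, trace_tensorPow, trace_tensorPow,
      trace_tensorPow, ← Matrix.transpose_mul, Matrix.trace_transpose, pow_add]
  simp only [h]
  rw [integral_trace_mul_tensorPow_ketbra hd, tensorPow_ketbra_mul_symProj,
    trace_tensorPow_ketbra, mul_one, div_eq_mul_inv]

theorem avgFidelity_TCP {d : ℕ} (hd : 1 ≤ d) (N K : ℕ) :
    avgFidelity (TCP d N K) = (dS d N : ℝ) / (dS d (N + K) : ℝ) := by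
  have := isProbabilityMeasure_haar hd
  have h : ∀ φ : PureState d, fidelity (TCP d N K (tensorPow N (ketbra φ)))
      (tensorPow K (ketbra φ).transpose) = (dS d N : ℝ) / (dS d (N + K) : ℝ) := by
    intro φ
    rw [fidelity, trace_TCP_tensorPow_mul hd, ← Complex.ofReal_natCast, ← Complex.ofReal_natCast,
      ← Complex.ofReal_div, Complex.ofReal_re]
  simp [avgFidelity, h]

theorem avgFidelity_estimationChannel {d : ℕ} (hd : 1 ≤ d) (N K : ℕ) :
    avgFidelity (estimationChannel hd N K) = (dS d N : ℝ) / (dS d (N + K) : ℝ) := by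
  rw [← avgFidelity_TCP hd, avgFidelity, avgFidelity]
  simp only [estimationChannel_eq_TCP hd (isSymOp_tensorPow_ketbra N _)]

/-! ### The upper bound through the Choi operator -/

/-- The Choi operator of a map, as an operator on `N + K` systems. -/
noncomputable def choi {d N K : ℕ} (C : Op d N →ₗ[ℂ] Op d K) : Op d (N + K) :=
  Matrix.of fun p q =>
    C (Matrix.single (fun s => p (Fin.castAdd K s)) (fun s => q (Fin.castAdd K s)) 1)
      (fun s => p (Fin.natAdd N s)) (fun s => q (Fin.natAdd N s))

theorem choi_append {d N K : ℕ} (C : Op d N →ₗ[ℂ] Op d K) (c x : Idx d N) (a b : Idx d K) :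
    choi C (Fin.append c a) (Fin.append x b) = C (Matrix.single c x 1) a b := by
  simp [choi]

theorem choi_posSemidef {d N K : ℕ} {C : Op d N →ₗ[ℂ] Op d K} (hC : IsCP C) :
    (choi C).PosSemidef :=
  hC.choi_posSemidef.submatrix fun p : Idx d (N + K) =>
    (fun s => p (Fin.castAdd K s), fun s => p (Fin.natAdd N s))

theorem map_apply_eq_sum {d N K : ℕ} (C : Op d N →ₗ[ℂ] Op d K) (A : Op d N) (a b : Idx d K) :
    C A a b = ∑ c, ∑ x, A c x * C (Matrix.single c x 1) a b := by
  conv_lhs => rw [Matrix.matrix_eq_sum_single A]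
  simp only [map_sum, Matrix.sum_apply]
  refine Finset.sum_congr rfl fun c _ => Finset.sum_congr rfl fun x _ => ?_
  rw [← mul_one (A c x), ← smul_eq_mul (A c x), ← Matrix.smul_single, map_smul,
    Matrix.smul_apply, smul_eq_mul, smul_eq_mul, mul_one]

theorem trace_map_mul_eq_choi {d N K : ℕ} (C : Op d N →ₗ[ℂ] Op d K) (A : Op d N) (B : Op d K) :
    (C A * B).trace = ((choi C)ᵀ * opTensor A Bᵀ).trace := by
  have hl : (C A * B).trace =
      ∑ a, ∑ b, ∑ c, ∑ x, C (Matrix.single c x 1) a b * (A c x * B b a) := by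
    simp only [Matrix.trace, Matrix.diag, Matrix.mul_apply]
    refine Finset.sum_congr rfl fun a _ => Finset.sum_congr rfl fun b _ => ?_
    rw [map_apply_eq_sum, Finset.sum_mul]
    refine Finset.sum_congr rfl fun c _ => ?_
    rw [Finset.sum_mul]
    refine Finset.sum_congr rfl fun x _ => ?_
    ring
  have hr : ((choi C)ᵀ * opTensor A Bᵀ).trace =
      ∑ x, ∑ b, ∑ c, ∑ a, C (Matrix.single c x 1) a b * (A c x * B b a) := by
    simp only [Matrix.trace, Matrix.diag, Matrix.mul_apply, sum_append, Matrix.transpose_apply,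
      choi_append, opTensor_append]
  rw [hl, hr, Finset.sum_comm, Finset.sum_comm (s := (Finset.univ : Finset (Idx d N)))]
  refine Finset.sum_congr rfl fun b _ => ?_
  rw [Finset.sum_congr rfl fun a _ => Finset.sum_comm, Finset.sum_comm]
  exact Finset.sum_congr rfl fun x _ => Finset.sum_comm

theorem trace_choi_mul_opTensor_one {d N K : ℕ} {C : Op d N →ₗ[ℂ] Op d K}
    (hC : ∀ ρ, (C ρ).trace = ρ.trace) (A : Op d N) :
    ((choi C)ᵀ * opTensor A (1 : Op d K)).trace = A.trace := by
  have h := trace_map_mul_eq_choi C A 1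
  rw [mul_one, hC, Matrix.transpose_one] at h
  exact h.symm

/-- The Choi pairing transposes the output observable, which undoes the transpose in the target and
leaves `ψ^{⊗(N+K)}`. -/
theorem avgFidelity_eq_trace_choi {d : ℕ} (hd : 1 ≤ d) {N K : ℕ} (C : Op d N →ₗ[ℂ] Op d K) :
    avgFidelity C = ((choi C)ᵀ * symProj d (N + K)).trace.re / (dS d (N + K) : ℝ) := by
  have h : ∀ ψ : PureState d, fidelity (C (tensorPow N (ketbra ψ)))
      (tensorPow K (ketbra ψ).transpose) =
      (((choi C)ᵀ * tensorPow (N + K) (ketbra ψ)).trace).re := by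
    intro ψ
    rw [fidelity, trace_map_mul_eq_choi]
    congr 4
    ext p q
    simp only [opTensor, tensorPow, Matrix.of_apply, Fin.prod_univ_add, Matrix.transpose_apply]
  simp only [avgFidelity, h]
  have hre := integral_re (𝕜 := ℂ) (integrable_of_continuous hd
    (continuous_trace_mul_tensorPow_ketbra (choi C)ᵀ))
  simp only [RCLike.re_eq_complex_re] at hre
  rw [hre, integral_trace_mul_tensorPow_ketbra hd, ← Complex.ofReal_natCast,
    ← Complex.ofReal_inv, Complex.re_ofReal_mul, div_eq_inv_mul]

theorem avgFidelity_le {d : ℕ} (hd : 1 ≤ d) {N K : ℕ} {C : Op d N →ₗ[ℂ] Op d K}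
    (hC : IsCPTP C) : avgFidelity C ≤ (dS d N : ℝ) / (dS d (N + K) : ℝ) := by
  rw [avgFidelity_eq_trace_choi hd]
  -- Pairing `Jᵀ ≥ 0` with `Π^{(N)} ⊗ 1 - Π^{(N+K)} ≥ 0`; trace preservation evaluates the first
  -- term to `Tr Π^{(N)} = d_S^N`.
  have h := trace_mul_nonneg_of_projection (choi_posSemidef hC.cp).transpose
    (opTensor_symProj_one_sub_isHermitian d N K) (opTensor_symProj_one_sub_mul_self d N K)
  rw [mul_sub, Matrix.trace_sub, trace_choi_mul_opTensor_one hC.tp, trace_symProj, sub_nonneg] at h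
  have h' := (Complex.le_def.1 h).1
  rw [Complex.natCast_re] at h'
  gcongr

theorem isEstimation_TCP {d : ℕ} (hd : 1 ≤ d) (N K : ℕ) :
    IsEstimation (symProj d N) (haar d) (fun ψ => (dS d N : ℂ) • tensorPow N (ketbra ψ))
      (fun ψ => tensorPow K (ketbra ψ).transpose) (TCP d N K) where
  povm_pos := fun ψ =>
    (tensorPow_ketbra_posSemidef N ψ).smul (Nat.cast_nonneg (dS d N) : (0 : ℂ) ≤ _)
  povm_integrable := fun i j =>
    integrable_of_continuous hd (continuous_const.mul (continuous_tensorPow_ketbra i j))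
  povm_complete := fun i j => by
    simp only [Matrix.smul_apply, smul_eq_mul]
    rw [integral_const_mul, integral_tensorPow_ketbra hd,
      mul_inv_cancel_left₀ (dS_cast_ne_zero hd N)]
  prep_measurable := fun i j => (continuous_tensorPow_ketbra j i).measurable
  prep_pos := tensorPow_transpose_ketbra_posSemidef K
  prep_trace := trace_tensorPow_transpose_ketbra K
  apply_eq := fun ρ _ i j => by
    rw [TCP, Matrix.of_apply, ← integral_const_mul]
    congr 1
    funext ψ
    rw [Matrix.smul_mul, Matrix.trace_smul, smul_eq_mul, Matrix.trace_mul_comm, mul_assoc]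

end QTranspose

open QTranspose in
theorem theorem1 (d N K : ℕ) (hd : 1 ≤ d) :
    -- the dimension of the symmetric subspaces
    (∀ M : ℕ, dS d M = (M + d - 1).choose (d - 1)) ∧
    -- the maximal average fidelity over all channels
    IsGreatest {F : ℝ | ∃ C : Op d N →ₗ[ℂ] Op d K, IsCPTP C ∧ F = avgFidelity C}
      ((dS d N : ℝ) / (dS d (N + K) : ℝ)) ∧
    -- `TCP` is an estimation strategy on the symmetric subspace
    IsEstimation (symProj d N) (haar d) (fun ψ => (dS d N : ℂ) • tensorPow N (ketbra ψ))
      (fun ψ => tensorPow K (ketbra ψ).transpose) (TCP d N K) ∧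
    -- on the symmetric subspace `TCP` is (the restriction of) a channel, and it is optimal
    (∃ C : Op d N →ₗ[ℂ] Op d K, IsCPTP C ∧ (∀ ρ, IsSymOp ρ → C ρ = TCP d N K ρ) ∧
      avgFidelity C = (dS d N : ℝ) / (dS d (N + K) : ℝ)) ∧
    avgFidelity (TCP d N K) = (dS d N : ℝ) / (dS d (N + K) : ℝ) ∧
    -- closed form of `TCP`
    (∀ ρ : Op d N, TCP d N K ρ =
      ((dS d N : ℂ) / (dS d (N + K) : ℂ)) •
        ptraceFirst (symProj d (N + K) * opTensor ρ.transpose (1 : Op d K))) := by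
  refine ⟨dS_eq_choose hd, ⟨?_, ?_⟩, isEstimation_TCP hd N K, ?_, avgFidelity_TCP hd N K,
    TCP_eq_ptraceFirst hd⟩
  · exact ⟨_, isCPTP_estimationChannel hd N K, (avgFidelity_estimationChannel hd N K).symm⟩
  · rintro _ ⟨C, hC, rfl⟩
    exact avgFidelity_le hd hC
  · exact ⟨_, isCPTP_estimationChannel hd N K, fun ρ hρ => estimationChannel_eq_TCP hd hρ,
      avgFidelity_estimationChannel hd N K⟩
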